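/- Let $R$ be a finite commutative ring with unity, and let $R \cong R_0\times R_1\times\cdots\times R_s$ ($s\ge 0$), where each $R_i$ is a local ring with maximal ideal $M_i$. Assume that $|R_0|/|M_0|\equiv 3 \pmod 4$ and $|R_i|/|M_i|\equiv 1 \pmod 4$ for every $1\le i\le s$. Let $Q_R=\{u^2 : u\in R^\times\}$ and $T_R=Q_R\cup(-Q_R)$, and let $\mathcal{G}_R$ be the quadratic unitary Cayley graph over $R$, that is, the graph with vertex set $R$ in which $u$ and $v$ are adjacent if and only if $u-v\in T_R$. For a finite simple graph $G$ with vertex set $V$, let $\mathcal{A}=\{(u,v) : u,v\in V \text{ adjacent}\}$ be its set of arcs; the arc $a=(u,v)$ has head $t(a)=v$ and inverse $a^{-1}=(v,u)$. Let $N\in\mathbb{C}^{V\times\mathcal{A}}$ and $S\in\mathbb{C}^{\mathcal{A}\times\mathcal{A}}$ be given by $N_{ua}=\frac{1}{\sqrt{\deg u}}\,\delta_{u,t(a)}$ and $S_{ab}=\delta_{a,b^{-1}}$, and let $U=S(2N^*N-I)$ be the time evolution matrix of the Grover walk on $G$. The graph $G$ is called periodic if $U^\tau=I$ for some positive integer $\tau$.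 Then $\mathcal{G}_R$ is periodic if and only if $s=0$ and $R_0/M_0\cong\mathbb{Z}_3$ (as rings). -/

import Mathlib

/-- The set `Q_R = {u ^ 2 : u ∈ Rˣ}` of squares of units of `R`. -/
def unitSquares (R : Type*) [CommRing R] : Set R :=
  {x | ∃ u : Rˣ, x = (u : R) ^ 2}

/-- The set `T_R = Q_R ∪ (-Q_R)`. -/
def signedUnitSquares (R : Type*) [CommRing R] : Set R :=
  {x | x ∈ unitSquares R ∨ -x ∈ unitSquares R}

theorem neg_mem_signedUnitSquares {R : Type*} [CommRing R] {x : R}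
    (hx : x ∈ signedUnitSquares R) : -x ∈ signedUnitSquares R := by
  rcases hx with h | h
  · exact Or.inr (by rwa [neg_neg])
  · exact Or.inl h

/-- For a ring with `1 ≠ 0`, the connection set `T_R` does not contain `0`. -/
theorem zero_notMem_signedUnitSquares (R : Type*) [CommRing R] [Nontrivial R] :
    (0 : R) ∉ signedUnitSquares R := by
  have h0 : (0 : R) ∉ unitSquares R := by
    rintro ⟨u, hu⟩
    exact (u ^ 2).ne_zero (by rw [Units.val_pow_eq_pow_val, ← hu])
  rintro (h | h)
  · exact h0 h
  · exact h0 (by rwa [neg_zero] at h)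

/-- The quadratic unitary Cayley graph `Cay(R, T_R)`: the vertex set is `R`, and distinct vertices
`u`, `v` are adjacent iff `u - v` or `v - u` is the square of a unit. -/
def quadraticUnitaryCayleyGraph (R : Type*) [CommRing R] : SimpleGraph R :=
  SimpleGraph.circulantGraph (signedUnitSquares R)

/-- For a ring with `1 ≠ 0`, adjacency of `u` and `v` is exactly `u - v ∈ T_R`. -/
theorem quadraticUnitaryCayleyGraph_adj {R : Type*} [CommRing R] [Nontrivial R] (u v : R) :
    (quadraticUnitaryCayleyGraph R).Adj u v ↔ u - v ∈ signedUnitSquares R := by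
  rw [quadraticUnitaryCayleyGraph, SimpleGraph.circulantGraph_adj]
  constructor
  · rintro ⟨-, h | h⟩
    · exact h
    · have h' := neg_mem_signedUnitSquares h
      rwa [neg_sub] at h'
  · intro h
    refine ⟨?_, Or.inl h⟩
    rintro rfl
    rw [sub_self] at h
    exact zero_notMem_signedUnitSquares R h

section GroverWalk

/-- The boundary matrix `N`, indexed by vertices and symmetric arcs:
`N u a = 1 / √(deg u)` if `u` is the head of the arc `a`, and `0` otherwise.
A dart `a` is the arc from its tail `a.fst` to its head `a.snd`. -/
noncomputable def groverBoundary {V : Type*} [Fintype V] [DecidableEq V] (G : SimpleGraph V)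
    [DecidableRel G.Adj] : Matrix V G.Dart ℂ :=
  Matrix.of fun u a => if u = a.snd then 1 / ((Real.sqrt (G.degree u : ℝ) : ℝ) : ℂ) else 0

/-- The shift matrix `S`, with `S a b = 1` if `a` is the inverse arc of `b`, and `0` otherwise. -/
def groverShift {V : Type*} [DecidableEq V] (G : SimpleGraph V) : Matrix G.Dart G.Dart ℂ :=
  Matrix.of fun a b => if a = b.symm then 1 else 0

/-- The time evolution matrix `U = S (2 N* N - I)` of the Grover walk on `G`. -/
noncomputable def groverEvolution {V : Type*} [Fintype V] [DecidableEq V] (G : SimpleGraph V)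
    [DecidableRel G.Adj] : Matrix G.Dart G.Dart ℂ :=
  groverShift G * ((2 : ℂ) • ((groverBoundary G).conjTranspose * groverBoundary G) - 1)

/-- The Grover walk on `G` is periodic: `U ^ τ = I` for some positive integer `τ`. -/
def IsGroverPeriodic {V : Type*} [Fintype V] [DecidableEq V] (G : SimpleGraph V)
    [DecidableRel G.Adj] : Prop :=
  ∃ τ : ℕ, 0 < τ ∧ groverEvolution G ^ τ = 1

end GroverWalk

/-! On the range of `Nᴴ`, an eigenvalue `p` of the normalized adjacency matrix turns into roots of
`z² - 2pz + 1` as eigenvalues of `U`. Periodicity makes these roots of unity, so `2p = z + z⁻¹` is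
an algebraic integer (`IsGroverPeriodic.isIntegral_eigenvalue`).

Additive characters of residue fields give eigenvalues expressed by quadratic Gauss sums
(`isIntegral_average_addChar`). For `q₀ ≡ 3 mod 4`, `-1` is a nonsquare and the Gauss sums cancel,
so `2p = -2/(q₀ - 1)` and `q₀ = 3`. A further factor with `q₁ ≡ 1 mod 4` yields two values of `2p`
built from `g` and `-g` with `g² = q₁`; their product `-4/((q₀ - 1)²(q₁ - 1))` is a nonzero rational
of size below 1, hence not an integer.

Conversely, for a local ring with residue field `ZMod 3` the graph is a balanced blow-up of a
triangle, with `p` in `{1, -1/2, 0}`. All roots `z` are then 12th roots of unity, and unitarity of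
`U` gives `U ^ 12 = 1`. -/

open Matrix

/-! ### Arc sums and the matrices `N` and `S` -/

section Darts

variable {V : Type*} [Fintype V] (G : SimpleGraph V) [DecidableRel G.Adj]

theorem SimpleGraph.sum_darts {M : Type*} [AddCommMonoid M] (g : V → V → M) :
    ∑ a : G.Dart, g a.fst a.snd = ∑ u, ∑ v, if G.Adj u v then g u v else 0 := by
  rw [← Fintype.sum_prod_type' (f := fun u v => if G.Adj u v then g u v else 0),
    ← Finset.sum_filter]
  refine Finset.sum_bij (fun a _ => a.toProd) ?_ ?_ ?_ ?_
  · intro a _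
    simp [a.adj]
  · intro a _ b _ h
    exact SimpleGraph.Dart.ext _ _ h
  · intro p hp
    exact ⟨⟨p, by simpa using hp⟩, Finset.mem_univ _, rfl⟩
  · intro a _
    rfl

theorem SimpleGraph.sum_ite_adj_left (u : V) :
    ∑ v, (if G.Adj v u then (1 : ℂ) else 0) = G.degree u := by
  simp_rw [G.adj_comm _ u]
  rw [Finset.sum_boole, ← SimpleGraph.card_neighborFinset_eq_degree,
    SimpleGraph.neighborFinset_eq_filter]

theorem groverShift_conjTranspose {V : Type*} [DecidableEq V] (G : SimpleGraph V) :
    (groverShift G)ᴴ = groverShift G := by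
  ext a b
  simp only [groverShift, conjTranspose_apply, Matrix.of_apply]
  have : (b = a.symm) ↔ a = b.symm := by constructor <;> rintro rfl <;> simp
  simp only [this]
  split_ifs <;> simp

variable [DecidableEq V]

theorem groverShift_mul_apply {ι : Type*} (X : Matrix G.Dart ι ℂ) (a : G.Dart) (b : ι) :
    (groverShift G * X) a b = X a.symm b := by
  rw [Matrix.mul_apply]
  have : ∀ c : G.Dart, (a = c.symm) ↔ c = a.symm := fun c => by
    constructor <;> rintro rfl <;> simp
  simp [groverShift, this]

theorem groverShift_mul_self : groverShift G * groverShift G = 1 := by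
  ext a b
  rw [groverShift_mul_apply, Matrix.one_apply]
  simp only [groverShift, Matrix.of_apply]
  congr 1
  simpa using (SimpleGraph.Dart.symm_involutive (G := G)).injective.eq_iff (a := a) (b := b)

theorem groverBoundary_mul_conjTranspose (hd : ∀ u, 0 < G.degree u) :
    groverBoundary G * (groverBoundary G)ᴴ = 1 := by
  ext u v
  rw [Matrix.mul_apply]
  simp only [groverBoundary, conjTranspose_apply, Matrix.of_apply]
  rw [G.sum_darts (fun x y => (if u = y then 1 / ((Real.sqrt (G.degree u : ℝ) : ℝ) : ℂ) else 0) *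
    star (if v = y then 1 / ((Real.sqrt (G.degree v : ℝ) : ℝ) : ℂ) else 0)), Finset.sum_comm]
  rw [Finset.sum_eq_single u _ (by simp)]
  · by_cases h : u = v
    · subst h
      have key : (1 / ((Real.sqrt (G.degree u : ℝ) : ℝ) : ℂ)) *
          star (1 / ((Real.sqrt (G.degree u : ℝ) : ℝ) : ℂ)) = (G.degree u : ℂ)⁻¹ := by
        rw [star_div₀, star_one, Complex.star_def, Complex.conj_ofReal, div_mul_div_comm, one_mul,
          ← Complex.ofReal_mul, Real.mul_self_sqrt (Nat.cast_nonneg _), one_div]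
        simp
      have : ((G.degree u : ℕ) : ℂ) ≠ 0 := by exact_mod_cast (hd u).ne'
      simp only [if_true, key]
      have : ∀ x, (if G.Adj x u then (G.degree u : ℂ)⁻¹ else 0)
          = (if G.Adj x u then (1 : ℂ) else 0) * (G.degree u : ℂ)⁻¹ := fun x => by
        split_ifs <;> simp
      simp_rw [this]
      rw [← Finset.sum_mul, G.sum_ite_adj_left, Matrix.one_apply_eq]
      field_simp
    · simp [h, Ne.symm h]
  · intro y _ hy
    simp [Ne.symm hy]

/-- Since `S` swaps head and tail, the entry at `(u, v)` counts arcs from `v` to `u`, each with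
weight `1 / d`. -/
theorem groverBoundary_mul_shift_mul {d : ℕ} (hd : G.IsRegularOfDegree d) :
    groverBoundary G * groverShift G * (groverBoundary G)ᴴ = (d : ℂ)⁻¹ • G.adjMatrix ℂ := by
  ext u v
  rw [Matrix.mul_assoc, Matrix.mul_apply]
  simp only [groverShift_mul_apply]
  simp only [groverBoundary, conjTranspose_apply, Matrix.of_apply, hd.degree_eq]
  refine (G.sum_darts (fun x y => (if u = y then 1 / ((Real.sqrt (d : ℝ) : ℝ) : ℂ) else 0) *
    star (if v = x then 1 / ((Real.sqrt (d : ℝ) : ℝ) : ℂ) else 0))).trans ?_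
  rw [Finset.sum_eq_single v _ (by simp), Finset.sum_eq_single u _ (by simp)]
  · have key : (1 / ((Real.sqrt (d : ℝ) : ℝ) : ℂ)) *
        star (1 / ((Real.sqrt (d : ℝ) : ℝ) : ℂ)) = (d : ℂ)⁻¹ := by
      rw [star_div₀, star_one, Complex.star_def, Complex.conj_ofReal, div_mul_div_comm, one_mul,
        ← Complex.ofReal_mul, Real.mul_self_sqrt (Nat.cast_nonneg _), one_div]
      simp
    simp only [if_true, key, G.adj_comm v u, Matrix.smul_apply, SimpleGraph.adjMatrix_apply, smul_eq_mul,
      mul_ite, mul_one, mul_zero]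
  · intro y _ hy
    simp [Ne.symm hy]
  · intro y _ hy
    simp [Ne.symm hy]

end Darts

/-! ### Algebraic identities for `U` -/

section Evolution

variable {V : Type*} [Fintype V] [DecidableEq V] (G : SimpleGraph V) [DecidableRel G.Adj]

theorem groverCoin_mul_self (hd : ∀ u, 0 < G.degree u) :
    ((2 : ℂ) • ((groverBoundary G)ᴴ * groverBoundary G) - 1) *
      ((2 : ℂ) • ((groverBoundary G)ᴴ * groverBoundary G) - 1) = 1 := by
  have h : (groverBoundary G)ᴴ * groverBoundary G * ((groverBoundary G)ᴴ * groverBoundary G) =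
      (groverBoundary G)ᴴ * groverBoundary G := by
    rw [Matrix.mul_assoc, ← Matrix.mul_assoc (groverBoundary G),
      groverBoundary_mul_conjTranspose G hd, Matrix.one_mul]
  rw [sub_mul, mul_sub, one_mul, mul_one, smul_mul_smul_comm, h]
  module

theorem groverEvolution_conjTranspose_mul_self (hd : ∀ u, 0 < G.degree u) :
    (groverEvolution G)ᴴ * groverEvolution G = 1 := by
  rw [groverEvolution, conjTranspose_mul, groverShift_conjTranspose, Matrix.mul_assoc,
    ← Matrix.mul_assoc (groverShift G), groverShift_mul_self, Matrix.one_mul]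
  have : ((2 : ℂ) • ((groverBoundary G)ᴴ * groverBoundary G) - 1)ᴴ =
      (2 : ℂ) • ((groverBoundary G)ᴴ * groverBoundary G) - 1 := by
    simp [conjTranspose_mul]
  rw [this, groverCoin_mul_self G hd]

theorem groverEvolution_mul_boundary (hd : ∀ u, 0 < G.degree u) :
    groverEvolution G * (groverBoundary G)ᴴ = groverShift G * (groverBoundary G)ᴴ := by
  rw [groverEvolution, Matrix.mul_assoc, Matrix.sub_mul, Matrix.smul_mul, Matrix.mul_assoc,
    groverBoundary_mul_conjTranspose G hd, Matrix.mul_one, Matrix.one_mul]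
  congr 1
  module

/-- This is the source of `z² - 2pz + 1`: `U Nᴴ = S Nᴴ` because `N Nᴴ = 1`, and `N S Nᴴ` is the
normalized adjacency matrix on a regular graph. -/
theorem groverEvolution_sq_mul_boundary (hd : ∀ u, 0 < G.degree u) :
    groverEvolution G * (groverEvolution G * (groverBoundary G)ᴴ) =
      (2 : ℂ) • (groverEvolution G * (groverBoundary G)ᴴ *
        (groverBoundary G * groverShift G * (groverBoundary G)ᴴ)) - (groverBoundary G)ᴴ := by
  rw [groverEvolution_mul_boundary G hd, groverEvolution, Matrix.mul_assoc, Matrix.sub_mul,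
    Matrix.mul_sub, Matrix.one_mul, ← Matrix.mul_assoc (groverShift G) (groverShift G),
    groverShift_mul_self, Matrix.one_mul]
  simp [Matrix.mul_assoc]

/-- Expanding `S(2P - 1)S(2P - 1)` with `P = Nᴴ N`, every term but `S² = 1` begins with `P` or `S P
= U P`. A polynomial in `U` that kills `Nᴴ` therefore kills `U² - 1`. -/
theorem exists_groverEvolution_sq_sub_one (hd : ∀ u, 0 < G.degree u) :
    ∃ X Y : Matrix V G.Dart ℂ, groverEvolution G * groverEvolution G - 1 =
      (groverBoundary G)ᴴ * X + groverEvolution G * ((groverBoundary G)ᴴ * Y) := by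
  refine ⟨(-2 : ℂ) • groverBoundary G, (4 : ℂ) • (groverBoundary G * groverShift G *
      ((groverBoundary G)ᴴ * groverBoundary G)) - (2 : ℂ) • (groverBoundary G * groverShift G), ?_⟩
  rw [← Matrix.mul_assoc (groverEvolution G), groverEvolution_mul_boundary G hd, groverEvolution]
  have h := groverShift_mul_self G
  simp only [Matrix.sub_mul, Matrix.mul_sub, Matrix.mul_one, Matrix.mul_smul,
    Matrix.smul_mul, Matrix.mul_assoc, h]
  rw [← Matrix.mul_assoc (groverShift G) (groverShift G), h]
  simp only [Matrix.one_mul]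
  module

end Evolution

/-! ### From the adjacency spectrum to the walk -/

section Spectral

variable {V : Type*} [Fintype V] [DecidableEq V] (G : SimpleGraph V) [DecidableRel G.Adj]

theorem pow_mulVec_eq_smul {n : Type*} [Fintype n] [DecidableEq n] {U : Matrix n n ℂ}
    {w : n → ℂ} {z : ℂ} (h : U *ᵥ w = z • w) (k : ℕ) : U ^ k *ᵥ w = z ^ k • w := by
  induction k with
  | zero => simp
  | succ k ih => rw [pow_succ, ← mulVec_mulVec, h, mulVec_smul, ih, smul_smul, pow_succ']

theorem eigenvalue_pow_eq_one {n : Type*} [Fintype n] [DecidableEq n] {U : Matrix n n ℂ}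
    {w : n → ℂ} {z : ℂ} (h : U *ᵥ w = z • w) (hw : w ≠ 0) {k : ℕ} (hk : U ^ k = 1) :
    z ^ k = 1 := by
  have h2 := pow_mulVec_eq_smul h k
  rw [hk, one_mulVec] at h2
  have h3 : (z ^ k - 1) • w = 0 := by rw [sub_smul, one_smul, ← h2, sub_self]
  rcases smul_eq_zero.1 h3 with h4 | h4
  · exact sub_eq_zero.1 h4
  · exact absurd h4 hw

theorem isIntegral_of_pow_eq_one {z : ℂ} {k : ℕ} (hk : 0 < k) (h : z ^ k = 1) :
    IsIntegral ℤ z :=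
  IsIntegral.of_pow hk (h ▸ isIntegral_one)

/-- If the Grover walk on a regular graph is periodic, then twice each eigenvalue of the
normalized adjacency matrix is an algebraic integer. -/
theorem IsGroverPeriodic.isIntegral_eigenvalue (hG : IsGroverPeriodic G) {d : ℕ}
    (hd : G.IsRegularOfDegree d) (hd0 : 0 < d) {f : V → ℂ} (hf : f ≠ 0) {c : ℂ}
    (hc : G.adjMatrix ℂ *ᵥ f = c • f) : IsIntegral ℤ (2 * (c / d)) := by
  obtain ⟨τ, hτ, hU⟩ := hG
  have hpos : ∀ u, 0 < G.degree u := fun u => by rw [hd.degree_eq]; exact hd0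
  set U := groverEvolution G with hUdef
  set p : ℂ := c / d with hp
  set φ : G.Dart → ℂ := (groverBoundary G)ᴴ *ᵥ f with hφ
  have hφ0 : φ ≠ 0 := by
    intro h
    apply hf
    have := congrArg (fun x => groverBoundary G *ᵥ x) h
    simpa [hφ, mulVec_mulVec, groverBoundary_mul_conjTranspose G hpos] using this
  have hrec : U *ᵥ (U *ᵥ φ) = (2 * p) • (U *ᵥ φ) - φ := by
    have h := congrArg (fun M => M *ᵥ f) (groverEvolution_sq_mul_boundary G hpos)
    simp only [groverBoundary_mul_shift_mul G hd, sub_mulVec, smul_mulVec, ← mulVec_mulVec, hc,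
      mulVec_smul, smul_smul] at h
    rw [← hUdef, ← hφ] at h
    rw [h, hp]
    congr 2
    ring
  obtain ⟨r, hr⟩ : ∃ r : ℂ, r ^ 2 = p ^ 2 - 1 :=
    ⟨_, Complex.cpow_nat_inv_pow _ two_ne_zero⟩
  -- The roots are `p ± r`. Either `φ` is an eigenvector for `p - r`, or the nonzero defect `Uφ - (p
  -- - r)φ` is one for `p + r`.
  have hroot : ∃ z : ℂ, z ^ τ = 1 ∧ z ^ 2 - 2 * p * z + 1 = 0 := by
    by_cases hw : U *ᵥ φ - (p - r) • φ = 0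
    · exact ⟨p - r, eigenvalue_pow_eq_one (sub_eq_zero.1 hw) hφ0 hU, by linear_combination hr⟩
    · refine ⟨p + r, eigenvalue_pow_eq_one (w := U *ᵥ φ - (p - r) • φ) ?_ hw hU,
        by linear_combination hr⟩
      have h1 : (p + r) * (p - r) = 1 := by linear_combination -hr
      rw [mulVec_sub, hrec, mulVec_smul, smul_sub, smul_smul, h1]
      module
  obtain ⟨z, hz, hz2⟩ := hroot
  have hz0 : z ≠ 0 := by
    rintro rfl
    simp at hz2
  have hzi : (z⁻¹) ^ τ = 1 := by rw [inv_pow, hz, inv_one]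
  have : 2 * p = z + z⁻¹ := by
    field_simp
    linear_combination -hz2
  rw [this]
  exact (isIntegral_of_pow_eq_one hτ hz).add (isIntegral_of_pow_eq_one hτ hzi)

-- Normality gives `(Mᴴ M)³ = 0`; repeated use of `Xᴴ X = 0 → X = 0` then lowers the exponent.
open scoped ComplexOrder in
theorem Matrix.eq_zero_of_isStarNormal_of_pow_three {n : Type*} [Fintype n] [DecidableEq n]
    {M : Matrix n n ℂ} (hM : Commute Mᴴ M) (h : M ^ 3 = 0) : M = 0 := by
  have hH : (Mᴴ * M)ᴴ = Mᴴ * M := by simp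
  have h4 : (Mᴴ * M) * (Mᴴ * M) * ((Mᴴ * M) * (Mᴴ * M)) = 0 := by
    have : (Mᴴ * M) ^ 3 = 0 := by rw [hM.mul_pow, h, mul_zero]
    calc _ = (Mᴴ * M) ^ 3 * (Mᴴ * M) := by noncomm_ring
      _ = 0 := by rw [this, zero_mul]
  have h2 : (Mᴴ * M) * (Mᴴ * M) = 0 := by
    apply conjTranspose_mul_self_eq_zero.1
    rw [conjTranspose_mul, hH, h4]
  have h1 : Mᴴ * M = 0 := by
    apply conjTranspose_mul_self_eq_zero.1
    rw [hH, h2]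
  exact conjTranspose_mul_self_eq_zero.1 h1

/-- The Grover walk is periodic if the normalized adjacency matrix has all its eigenvalues in
`{0, 1, -1 / 2}`. -/
theorem isGroverPeriodic_of_pow_three {d : ℕ} (hd : G.IsRegularOfDegree d) (hd0 : 0 < d)
    {q : Matrix V V ℂ} (hq : q = (2 * (d : ℂ)⁻¹) • G.adjMatrix ℂ)
    (h : q * q * q = q * q + (2 : ℂ) • q) : IsGroverPeriodic G := by
  have hpos : ∀ u, 0 < G.degree u := fun u => by rw [hd.degree_eq]; exact hd0
  -- The eigenvalues `0, 2, -1` of `q = 2p` give `z = ±i`, `z = 1` and the primitive cube roots of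
  -- unity; `U² = 1` contributes `±1`. The least common order is 12.
  refine ⟨12, by norm_num, ?_⟩
  obtain ⟨X, Y, hXY⟩ := exists_groverEvolution_sq_sub_one G hpos
  have hrec := groverEvolution_sq_mul_boundary G hpos
  rw [groverBoundary_mul_shift_mul G hd, Matrix.mul_smul, smul_smul, ← Matrix.mul_smul, ← hq] at hrec
  have hunit := groverEvolution_conjTranspose_mul_self G hpos
  set U := groverEvolution G
  set B := (groverBoundary G)ᴴ
  have h0 : (U * U + 1) * B = U * (B * q) := by
    rw [Matrix.add_mul, Matrix.mul_assoc, hrec, Matrix.one_mul, sub_add_cancel, Matrix.mul_assoc]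
  have h1 : (U * U + 1 - (2 : ℂ) • U) * B = U * (B * (q - (2 : ℂ) • 1)) := by
    rw [Matrix.sub_mul, h0, Matrix.mul_sub, Matrix.mul_sub, Matrix.smul_mul, Matrix.mul_smul,
      Matrix.mul_smul, Matrix.mul_one]
  have h2 : (U * U + 1 + U) * B = U * (B * (q + 1)) := by
    rw [Matrix.add_mul, h0, Matrix.mul_add, Matrix.mul_add, Matrix.mul_one]
  have hann : (U * U + 1) * ((U * U + 1 - (2 : ℂ) • U) * ((U * U + 1 + U) * B)) = 0 := by
    have e1 : (U * U + 1 - (2 : ℂ) • U) * U = U * (U * U + 1 - (2 : ℂ) • U) := by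
      simp only [sub_mul, mul_sub, add_mul, mul_add, one_mul, mul_one, Matrix.smul_mul,
        Matrix.mul_smul, Matrix.mul_assoc]
    have e0 : (U * U + 1) * U = U * (U * U + 1) := by
      simp only [add_mul, mul_add, one_mul, mul_one, Matrix.mul_assoc]
    have e2 : q * ((q - (2 : ℂ) • 1) * (q + 1)) = 0 := by
      have : q * ((q - (2 : ℂ) • 1) * (q + 1)) = q * q * q - (q * q + (2 : ℂ) • q) := by
        simp only [sub_mul, mul_sub, mul_add, one_mul, mul_one, Matrix.smul_mul,
          Matrix.mul_smul, Matrix.mul_assoc]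
        module
      rw [this, h, sub_self]
    have h0' (M : Matrix V V ℂ) : (U * U + 1) * (B * M) = U * (B * (q * M)) := by
      rw [← Matrix.mul_assoc, h0]
      simp only [Matrix.mul_assoc]
    have h1' (M : Matrix V V ℂ) : (U * U + 1 - (2 : ℂ) • U) * (B * M) =
        U * (B * ((q - (2 : ℂ) • 1) * M)) := by
      rw [← Matrix.mul_assoc, h1]
      simp only [Matrix.mul_assoc]
    have e0' (M : Matrix G.Dart V ℂ) : (U * U + 1) * (U * M) = U * ((U * U + 1) * M) := by
      rw [← Matrix.mul_assoc, e0, Matrix.mul_assoc]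
    have e1' (M : Matrix G.Dart V ℂ) : (U * U + 1 - (2 : ℂ) • U) * (U * M) =
        U * ((U * U + 1 - (2 : ℂ) • U) * M) := by
      rw [← Matrix.mul_assoc, e1, Matrix.mul_assoc]
    rw [h2, e1', h1', e0', e0', h0', e2]
    simp
  have hprod : (U * U + 1) * ((U * U + 1 - (2 : ℂ) • U) * (U * U + 1 + U)) * (U * U - 1) = 0 := by
    set L := (U * U + 1) * ((U * U + 1 - (2 : ℂ) • U) * (U * U + 1 + U)) with hL
    have hLB : L * B = 0 := by rw [← hann, hL]; simp only [Matrix.mul_assoc]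
    have hLU : L * U = U * L := by
      have hc : Commute U (U * U + 1) := ((Commute.refl U).mul_right (.refl U)).add_right (.one_right U)
      exact (hc.mul_right ((hc.sub_right ((Commute.refl U).smul_right (2 : ℂ))).mul_right
        (hc.add_right (.refl U)))).symm
    rw [hXY, Matrix.mul_add, ← Matrix.mul_assoc, hLB, ← Matrix.mul_assoc, hLU, Matrix.mul_assoc,
      ← Matrix.mul_assoc L, hLB]
    simp
  -- The annihilating polynomial has a triple root at `1`, hence the cube.
  have hnil : (U ^ 12 - 1) ^ 3 = 0 := by
    have hpoly : ((Polynomial.X : Polynomial ℂ) ^ 12 - 1) ^ 3 =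
        ((Polynomial.X ^ 2 - Polynomial.X + 1) * (Polynomial.X ^ 4 - Polynomial.X ^ 2 + 1) *
          ((Polynomial.X + 1) * (Polynomial.X ^ 2 + 1) * (Polynomial.X ^ 2 + Polynomial.X + 1) *
          (Polynomial.X ^ 2 - Polynomial.X + 1) * (Polynomial.X ^ 4 - Polynomial.X ^ 2 + 1)) ^ 2) *
        ((Polynomial.X * Polynomial.X + 1) *
          ((Polynomial.X * Polynomial.X + 1 - (Polynomial.X + Polynomial.X)) *
          (Polynomial.X * Polynomial.X + 1 + Polynomial.X)) *
          (Polynomial.X * Polynomial.X - 1)) := by ring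
    have h := congrArg (Polynomial.aeval U) hpoly
    rw [map_mul _ _ ((Polynomial.X * Polynomial.X + 1) * (_ * _) * _)] at h
    have hP : Polynomial.aeval U (((Polynomial.X : Polynomial ℂ) * Polynomial.X + 1) *
          ((Polynomial.X * Polynomial.X + 1 - (Polynomial.X + Polynomial.X)) *
          (Polynomial.X * Polynomial.X + 1 + Polynomial.X)) *
          (Polynomial.X * Polynomial.X - 1)) = 0 := by
      rw [← hprod]
      simp only [map_mul, map_sub, map_add, map_one, Polynomial.aeval_X, two_smul]
    rw [hP, mul_zero] at h
    simpa only [map_pow, map_sub, map_one, Polynomial.aeval_X] using h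
  have hunit' : U * Uᴴ = 1 := mul_eq_one_comm.1 hunit
  have hcomm : Commute Uᴴ U := hunit.trans hunit'.symm
  have hnormal : Commute (U ^ 12 - 1)ᴴ (U ^ 12 - 1) := by
    rw [conjTranspose_sub, conjTranspose_pow, conjTranspose_one]
    exact (((hcomm.pow_pow 12 12).sub_right (.one_right _)).sub_left (.one_left _))
  exact sub_eq_zero.1 (Matrix.eq_zero_of_isStarNormal_of_pow_three hnormal hnil)

end Spectral

/-! ### Averages over the connection set -/

section SignedSquares

variable {R : Type*} [CommRing R]

/-- The homomorphism `(ε, u) ↦ ε u ^ 2` from `{±1} × Rˣ` to `Rˣ`. -/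
def signedSquareHom (R : Type*) [CommRing R] : ℤˣ × Rˣ →* Rˣ :=
  MonoidHom.coprod (Units.map (Int.castRingHom R).toMonoidHom) (powMonoidHom 2)

theorem val_signedSquareHom (ε : ℤˣ) (u : Rˣ) :
    (signedSquareHom R (ε, u) : R) = ((ε : ℤ) : R) * (u : R) ^ 2 := by
  simp [signedSquareHom]

theorem mem_signedUnitSquares_iff {x : R} :
    x ∈ signedUnitSquares R ↔ ∃ g : ℤˣ × Rˣ, (signedSquareHom R g : R) = x := by
  constructor
  · rintro (⟨u, hu⟩ | ⟨u, hu⟩)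
    · exact ⟨(1, u), by simp [val_signedSquareHom, hu]⟩
    · exact ⟨(-1, u), by simp [val_signedSquareHom, ← hu]⟩
  · rintro ⟨⟨ε, u⟩, rfl⟩
    rw [val_signedSquareHom]
    rcases Int.units_eq_one_or ε with rfl | rfl
    · exact Or.inl ⟨u, by simp⟩
    · exact Or.inr ⟨u, by simp⟩

/-- All fibres of a surjective homomorphism have the same size, so averages are preserved; stated
cross-multiplied. -/
theorem MonoidHom.sum_comp_mul_card {G H : Type*} [Group G] [Group H] [Fintype G] [Fintype H]
    (φ : G →* H) (hφ : Function.Surjective φ) (F : H → ℂ) :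
    (∑ g, F (φ g)) * Fintype.card H = Fintype.card G * ∑ h, F h := by
  classical
  have key (F : H → ℂ) : ∑ g, F (φ g) =
      (Finset.univ.filter fun g => φ g = 1).card * ∑ h, F h := by
    rw [← Finset.sum_fiberwise_of_maps_to (t := Finset.univ) (g := φ) (by simp), Finset.mul_sum]
    refine Finset.sum_congr rfl fun h _ => ?_
    rw [Finset.sum_congr rfl (g := fun _ => F h) (by simp +contextual), Finset.sum_const,
      nsmul_eq_mul]
    congr 2
    exact MonoidHom.card_fiber_eq_of_mem_range φ (hφ h) (hφ 1)
  have h1 := key fun _ => 1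
  simp only [Finset.sum_const, Finset.card_univ, nsmul_eq_mul, mul_one] at h1
  rw [key F, h1]
  ring

variable [Fintype R] [DecidablePred (· ∈ signedUnitSquares R)]

/-- The average of a function over the connection set is its average over `{±1} × Rˣ`. -/
theorem sum_signedUnitSquares_mul [Fintype Rˣ] (F : R → ℂ) :
    (∑ g : ℤˣ × Rˣ, F (signedSquareHom R g)) *
        (Finset.univ.filter (· ∈ signedUnitSquares R)).card =
      Fintype.card (ℤˣ × Rˣ) * ∑ t with t ∈ signedUnitSquares R, F t := by
  classical
  have h := (signedSquareHom R).rangeRestrict.sum_comp_mul_card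
    (signedSquareHom R).rangeRestrict_surjective (fun h => F (h : Rˣ))
  have hsum (F : R → ℂ) : ∑ h : (signedSquareHom R).range, F (h : Rˣ) =
      ∑ t with t ∈ signedUnitSquares R, F t := by
    refine Finset.sum_bij (fun h _ => ((h : Rˣ) : R)) ?_ ?_ ?_ ?_
    · rintro ⟨h, g, rfl⟩ _
      simpa using mem_signedUnitSquares_iff.2 ⟨g, rfl⟩
    · intro a _ b _ h
      exact Subtype.ext (Units.ext h)
    · intro t ht
      obtain ⟨g, hg⟩ := mem_signedUnitSquares_iff.1 (Finset.mem_filter.1 ht).2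
      exact ⟨⟨signedSquareHom R g, g, rfl⟩, Finset.mem_univ _, hg⟩
    · intro _ _
      rfl
  have hcard := hsum fun _ => 1
  simp only [Finset.sum_const, Finset.card_univ, nsmul_eq_mul, mul_one] at hcard
  rw [hsum, hcard] at h
  exact h

theorem card_signedUnitSquares_pos :
    0 < (Finset.univ.filter (· ∈ signedUnitSquares R)).card :=
  Finset.card_pos.2 ⟨1, Finset.mem_filter.2 ⟨Finset.mem_univ _, Or.inl ⟨1, by simp⟩⟩⟩

end SignedSquares

/-! ### Eigenvalues from additive characters -/

section CayleyGraph

variable {R : Type*} [CommRing R] [Nontrivial R]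

theorem quadraticUnitaryCayleyGraph_adj_add (u t : R) :
    (quadraticUnitaryCayleyGraph R).Adj u (u + t) ↔ t ∈ signedUnitSquares R := by
  rw [SimpleGraph.adj_comm, quadraticUnitaryCayleyGraph_adj, add_sub_cancel_left]

variable [Fintype R] [DecidableRel (quadraticUnitaryCayleyGraph R).Adj]
  [DecidablePred (· ∈ signedUnitSquares R)]

theorem quadraticUnitaryCayleyGraph_adjMatrix_mulVec (f : R → ℂ) (u : R) :
    ((quadraticUnitaryCayleyGraph R).adjMatrix ℂ *ᵥ f) u =
      ∑ t with t ∈ signedUnitSquares R, f (u + t) := by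
  rw [mulVec, dotProduct, ← Equiv.sum_comp (Equiv.addLeft u), Finset.sum_filter]
  simp [SimpleGraph.adjMatrix_apply, quadraticUnitaryCayleyGraph_adj_add]

theorem quadraticUnitaryCayleyGraph_isRegularOfDegree :
    (quadraticUnitaryCayleyGraph R).IsRegularOfDegree
      (Finset.univ.filter (· ∈ signedUnitSquares R)).card := by
  intro u
  have h := quadraticUnitaryCayleyGraph_adjMatrix_mulVec (fun _ => 1) u
  have h2 : ((quadraticUnitaryCayleyGraph R).adjMatrix ℂ *ᵥ fun _ => 1) u =
      (quadraticUnitaryCayleyGraph R).degree u := by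
    simp [mulVec, dotProduct, SimpleGraph.adjMatrix_apply,
      ← SimpleGraph.card_neighborFinset_eq_degree, SimpleGraph.neighborFinset_eq_filter]
  rw [h2] at h
  simp only [Finset.sum_const, nsmul_eq_mul, mul_one] at h
  exact_mod_cast h

/-- An additive character of a quotient ring yields an eigenvalue of the graph. -/
theorem isIntegral_average_addChar [DecidableEq R]
    (hper : IsGroverPeriodic (quadraticUnitaryCayleyGraph R))
    {K : Type*} [CommRing K] [Fintype Kˣ] (π : R →+* K)
    (hπ : Function.Surjective (Units.map π.toMonoidHom)) (ψ : AddChar K ℂ) :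
    IsIntegral ℤ ((∑ u : Kˣ, (ψ ((u : K) ^ 2) + ψ (-(u : K) ^ 2))) / Fintype.card Kˣ) := by
  classical
  set c : ℂ := ∑ t with t ∈ signedUnitSquares R, ψ (π t) with hc
  set f : R → ℂ := fun x => ψ (π x) with hf
  have hf0 : f ≠ 0 := fun h => by simpa [hf] using congrFun h 0
  have heig : (quadraticUnitaryCayleyGraph R).adjMatrix ℂ *ᵥ f = c • f := by
    ext u
    rw [quadraticUnitaryCayleyGraph_adjMatrix_mulVec]
    simp only [hf, map_add, AddChar.map_add_eq_mul, Pi.smul_apply, smul_eq_mul, hc,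
      Finset.sum_mul]
    exact Finset.sum_congr rfl fun t _ => mul_comm _ _
  have hint := hper.isIntegral_eigenvalue _ quadraticUnitaryCayleyGraph_isRegularOfDegree
    card_signedUnitSquares_pos hf0 heig
  have h1 := sum_signedUnitSquares_mul (fun x => ψ (π x))
  have h2 := MonoidHom.sum_comp_mul_card
    ((MonoidHom.id ℤˣ).prodMap (Units.map π.toMonoidHom))
    (Function.surjective_id.prodMap hπ) (fun g => ψ (signedSquareHom K g))
  have h3 : ∀ g : ℤˣ × Rˣ, (signedSquareHom K ((MonoidHom.id ℤˣ).prodMap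
      (Units.map π.toMonoidHom) g) : K) = π (signedSquareHom R g) := by
    rintro ⟨ε, u⟩
    rw [val_signedSquareHom]
    simp [val_signedSquareHom]
  have h4 : ∑ g : ℤˣ × Kˣ, ψ (signedSquareHom K g) =
      ∑ u : Kˣ, (ψ ((u : K) ^ 2) + ψ (-(u : K) ^ 2)) := by
    rw [Fintype.sum_prod_type, UnitsInt.univ, Finset.sum_pair (by decide),
      ← Finset.sum_add_distrib]
    simp [val_signedSquareHom]
  simp only [h3, h4] at h2
  rw [← hc] at h1
  have hd : ((Finset.univ.filter (· ∈ signedUnitSquares R)).card : ℂ) ≠ 0 := by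
    exact_mod_cast card_signedUnitSquares_pos.ne'
  have hR : (Fintype.card (ℤˣ × Rˣ) : ℂ) ≠ 0 := by exact_mod_cast Fintype.card_ne_zero
  have hK : (Fintype.card Kˣ : ℂ) ≠ 0 := by exact_mod_cast Fintype.card_ne_zero
  -- The factor 2 from `ℤˣ` cancels the 2 in `2 * (c / d)`.
  have hcard : (Fintype.card (ℤˣ × Kˣ) : ℂ) = 2 * Fintype.card Kˣ := by
    rw [Fintype.card_prod]
    push_cast
    simp
  rw [hcard] at h2
  convert hint using 1
  have e1 : c / (Finset.univ.filter (· ∈ signedUnitSquares R)).card =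
      (∑ g : ℤˣ × Rˣ, ψ (π (signedSquareHom R g))) / Fintype.card (ℤˣ × Rˣ) := by
    rw [div_eq_div_iff hd hR, h1]
    ring
  rw [e1, mul_div_assoc', div_eq_div_iff hK hR]
  linear_combination -h2

end CayleyGraph

/-! ### Quadratic Gauss sums -/

section GaussSums

variable {k : Type*} [Field k] [Fintype k]

theorem exists_addChar_ne_one : ∃ ψ : AddChar k ℂ, ψ ≠ 1 := by
  obtain ⟨ψ, hψ⟩ := AddChar.exists_apply_ne_zero.2 (one_ne_zero (α := k))
  exact ⟨ψ, fun h => hψ (by simp [h])⟩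

theorem ringChar_ne_two_of_card_odd (h : Fintype.card k % 2 = 1) : ringChar k ≠ 2 := fun h2 => by
  have := FiniteField.even_card_of_char_two h2
  omega

variable [DecidableEq k]

theorem sum_units_eq_sub (f : k → ℂ) : ∑ u : kˣ, f u = ∑ x, f x - f 0 := by
  have h := Fintype.sum_subtype_add_sum_subtype (fun x : k => x ≠ 0) f
  rw [← h, ← Equiv.sum_comp unitsEquivNeZero]
  have : ∑ x : {x : k // ¬ x ≠ 0}, f x = f 0 := by
    rw [Fintype.sum_eq_single (⟨0, by simp⟩ : {x : k // ¬ x ≠ 0})]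
    rintro ⟨x, hx⟩ h
    exact absurd (Subtype.ext (not_not.1 hx)) h
  rw [this]
  simp

/-- The quadratic character with complex values. -/
noncomputable def complexQuadraticChar (k : Type*) [Field k] [Fintype k] [DecidableEq k] :
    MulChar k ℂ :=
  (quadraticChar k).ringHomComp (Int.castRingHom ℂ)

/-- Each `y` has `χ(y) + 1` square roots; the `+ 1` part vanishes as `∑ ψ = 0`, and the `- 1`
removes `x = 0`. -/
theorem sum_addChar_unit_sq (hk : ringChar k ≠ 2) {ψ : AddChar k ℂ} (hψ : ψ ≠ 1) :
    ∑ u : kˣ, ψ ((u : k) ^ 2) = gaussSum (complexQuadraticChar k) ψ - 1 := by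
  rw [sum_units_eq_sub fun x => ψ (x ^ 2)]
  congr 1
  · rw [← Finset.sum_fiberwise_of_maps_to (t := Finset.univ) (g := fun x : k => x ^ 2) (by simp)]
    have h (y : k) : ∑ x : k with x ^ 2 = y, ψ (x ^ 2) =
        complexQuadraticChar k y * ψ y + ψ y := by
      have h1 := quadraticChar_card_sqrts hk y
      rw [Finset.sum_congr rfl (g := fun _ => ψ y) (by simp +contextual), Finset.sum_const,
        nsmul_eq_mul, ← add_one_mul]
      congr 1
      simp only [Set.toFinset_ofPred] at h1
      have h2 := congrArg (Int.cast : ℤ → ℂ) h1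
      push_cast at h2
      rw [h2]
      rfl
    rw [Finset.sum_congr rfl fun y _ => h y, Finset.sum_add_distrib,
      AddChar.sum_eq_zero_of_ne_one hψ, add_zero]
    rfl
  · simp

theorem complexQuadraticChar_isQuadratic : (complexQuadraticChar k).IsQuadratic :=
  (quadraticChar_isQuadratic k).comp _

theorem complexQuadraticChar_ne_one (hk : ringChar k ≠ 2) : complexQuadraticChar k ≠ 1 := by
  rw [complexQuadraticChar, ne_eq, MulChar.ringHomComp_eq_one_iff]
  · exact quadraticChar_ne_one hk
  · exact Int.cast_injective

theorem complexQuadraticChar_neg_one (hk : ringChar k ≠ 2) :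
    complexQuadraticChar k (-1) = if Fintype.card k % 4 = 1 then 1 else -1 := by
  have h : complexQuadraticChar k (-1) = ((quadraticChar k (-1) : ℤ) : ℂ) := rfl
  have hodd := FiniteField.odd_card_of_char_ne_two hk
  rw [h, quadraticChar_neg_one hk]
  have : Fintype.card k % 4 = 1 ∨ Fintype.card k % 4 = 3 := by omega
  rcases this with h | h
  · rw [ZMod.χ₄_nat_one_mod_four h]
    simp [h]
  · rw [ZMod.χ₄_nat_three_mod_four h]
    simp [h]

theorem sum_addChar_neg_unit_sq (hk : ringChar k ≠ 2) {ψ : AddChar k ℂ} (hψ : ψ ≠ 1) :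
    ∑ u : kˣ, ψ (-(u : k) ^ 2) =
      complexQuadraticChar k (-1) * gaussSum (complexQuadraticChar k) ψ - 1 := by
  have hne : ψ.mulShift (-1) ≠ 1 := AddChar.IsPrimitive.of_ne_one hψ (by simp)
  have h := sum_addChar_unit_sq hk hne
  have h2 := gaussSum_mulShift_eq (complexQuadraticChar k) ψ (-1)
  rw [complexQuadraticChar_isQuadratic.inv] at h2
  simp only [Units.val_neg, Units.val_one] at h2
  rw [h2] at h
  simpa using h

/-- Twisting `ψ` by a nonsquare flips the sign. -/
theorem exists_addChar_gaussSum_eq_neg (hk : ringChar k ≠ 2) {ψ : AddChar k ℂ} (hψ : ψ ≠ 1) :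
    ∃ ψ' : AddChar k ℂ, ψ' ≠ 1 ∧
      gaussSum (complexQuadraticChar k) ψ' = -gaussSum (complexQuadraticChar k) ψ := by
  obtain ⟨a, ha⟩ := quadraticChar_exists_neg_one' hk
  refine ⟨ψ.mulShift a, AddChar.IsPrimitive.of_ne_one hψ a.ne_zero, ?_⟩
  rw [gaussSum_mulShift_eq, complexQuadraticChar_isQuadratic.inv]
  have : complexQuadraticChar k a = ((quadraticChar k a : ℤ) : ℂ) := rfl
  rw [this, ha]
  simp

end GaussSums

/-! ### Rational algebraic integers -/

section Arithmetic

theorem exists_int_of_isIntegral_div {a b : ℤ} (h : IsIntegral ℤ ((a : ℂ) / b)) :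
    ∃ n : ℤ, (n : ℂ) = a / b := by
  have h' : IsIntegral ℤ ((a : ℚ) / b) := by
    rw [← isIntegral_algebraMap_iff (B := ℂ) (algebraMap ℚ ℂ).injective]
    simpa using h
  obtain ⟨n, hn⟩ := IsIntegrallyClosed.isIntegral_iff.1 h'
  refine ⟨n, ?_⟩
  have := congrArg (algebraMap ℚ ℂ) hn
  simpa using this

end Arithmetic

/-! ### Obstructions to periodicity -/

section Necessity

variable {R : Type*} [CommRing R] [Nontrivial R] [Fintype R] [DecidableEq R]
  [DecidableRel (quadraticUnitaryCayleyGraph R).Adj]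

theorem card_eq_three_of_isGroverPeriodic
    (hper : IsGroverPeriodic (quadraticUnitaryCayleyGraph R))
    {k : Type*} [Field k] [Fintype k] (π : R →+* k)
    (hπ : Function.Surjective (Units.map π.toMonoidHom)) (hk : Fintype.card k % 4 = 3) :
    Fintype.card k = 3 := by
  classical
  have hk2 := ringChar_ne_two_of_card_odd (k := k) (by omega)
  obtain ⟨ψ, hψ⟩ := exists_addChar_ne_one (k := k)
  have h := isIntegral_average_addChar hper π hπ ψ
  rw [Finset.sum_add_distrib, sum_addChar_unit_sq hk2 hψ, sum_addChar_neg_unit_sq hk2 hψ,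
    complexQuadraticChar_neg_one hk2, if_neg (by omega), Fintype.card_units] at h
  set q := Fintype.card k
  obtain ⟨m, hm⟩ : ∃ m, q = m + 1 := ⟨q - 1, by omega⟩
  have h' : IsIntegral ℤ (((-2 : ℤ) : ℂ) / (m : ℤ)) := by
    convert h using 1
    rw [hm]
    push_cast
    congr 1
    ring
  obtain ⟨n, hn⟩ := exists_int_of_isIntegral_div h'
  have hm0 : ((m : ℤ) : ℂ) ≠ 0 := by
    have : (m : ℤ) ≠ 0 := by omega
    exact_mod_cast this
  rw [eq_div_iff hm0] at hn
  have hn' : n * m = -2 := by exact_mod_cast hn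
  have hdvd : (m : ℤ) ∣ 2 := ⟨-n, by linarith⟩
  have := Int.le_of_dvd (by norm_num) hdvd
  omega

theorem not_isGroverPeriodic_of_two_residue_fields
    {k₀ k₁ : Type*} [Field k₀] [Field k₁] [Fintype k₀] [Fintype k₁] (π : R →+* k₀ × k₁)
    (hπ : Function.Surjective (Units.map π.toMonoidHom)) (hk₀ : Fintype.card k₀ % 4 = 3)
    (hk₁ : Fintype.card k₁ % 4 = 1) :
    ¬ IsGroverPeriodic (quadraticUnitaryCayleyGraph R) := by
  classical
  intro hper
  have hc₀ := ringChar_ne_two_of_card_odd (k := k₀) (by omega)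
  have hc₁ := ringChar_ne_two_of_card_odd (k := k₁) (by omega)
  obtain ⟨ψ₀, hψ₀⟩ := exists_addChar_ne_one (k := k₀)
  obtain ⟨ψ₁, hψ₁⟩ := exists_addChar_ne_one (k := k₁)
  obtain ⟨ψ₂, hψ₂, hg⟩ := exists_addChar_gaussSum_eq_neg hc₁ hψ₁
  set q₀ := Fintype.card k₀ with hq₀
  set q₁ := Fintype.card k₁ with hq₁
  obtain ⟨m₀, hm₀⟩ : ∃ m, q₀ = m + 1 := ⟨q₀ - 1, by omega⟩
  obtain ⟨m₁, hm₁⟩ : ∃ m, q₁ = m + 1 := ⟨q₁ - 1, by omega⟩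
  have hm₁4 : 4 ≤ m₁ := by
    have : 1 < q₁ := Fintype.one_lt_card
    omega
  -- For the character `ψ₀ ⊗ ψ` the sum is `(g₀ - 1)(g - 1) + (-g₀ - 1)(g - 1) = -2(g - 1)`, free of
  -- `g₀`.
  have key (ψ : AddChar k₁ ℂ) (hψ : ψ ≠ 1) :
      IsIntegral ℤ (-2 * (gaussSum (complexQuadraticChar k₁) ψ - 1) / ((m₀ * m₁ : ℕ) : ℂ)) := by
    have h := isIntegral_average_addChar hper π hπ
      (ψ₀.compAddMonoidHom (AddMonoidHom.fst k₀ k₁) * ψ.compAddMonoidHom (AddMonoidHom.snd k₀ k₁))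
    convert h using 2
    · rw [← Equiv.sum_comp MulEquiv.prodUnits.symm.toEquiv, Fintype.sum_prod_type]
      have e (u : k₀ˣ) (v : k₁ˣ) : ((MulEquiv.prodUnits.symm.toEquiv (u, v) : (k₀ × k₁)ˣ) :
          k₀ × k₁) = ((u : k₀), (v : k₁)) := rfl
      simp only [e, AddChar.mul_apply, AddChar.compAddMonoidHom_apply, AddMonoidHom.coe_fst,
        AddMonoidHom.coe_snd, Prod.fst_neg, Prod.snd_neg, Prod.pow_fst, Prod.pow_snd,
        Finset.sum_add_distrib, ← Finset.mul_sum, ← Finset.sum_mul]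
      rw [sum_addChar_unit_sq hc₀ hψ₀, sum_addChar_neg_unit_sq hc₀ hψ₀,
        sum_addChar_unit_sq hc₁ hψ, sum_addChar_neg_unit_sq hc₁ hψ,
        complexQuadraticChar_neg_one hc₀, if_neg (by omega),
        complexQuadraticChar_neg_one hc₁, if_pos (by omega)]
      ring
    · rw [Fintype.card_congr MulEquiv.prodUnits.toEquiv, Fintype.card_prod, Fintype.card_units,
        Fintype.card_units, ← hq₀, ← hq₁, hm₀, hm₁]
      simp
  have hprod := (key ψ₁ hψ₁).mul (key ψ₂ hψ₂)
  have hsq := gaussSum_sq (complexQuadraticChar_ne_one hc₁) complexQuadraticChar_isQuadratic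
    (AddChar.IsPrimitive.of_ne_one hψ₁)
  rw [complexQuadraticChar_neg_one hc₁, if_pos (by omega), ← hq₁, hm₁, one_mul] at hsq
  push_cast at hsq
  have hm₀0 : (m₀ : ℂ) ≠ 0 := by
    have : m₀ ≠ 0 := by omega
    exact_mod_cast this
  have hm₁0 : (m₁ : ℂ) ≠ 0 := by
    have : m₁ ≠ 0 := by omega
    exact_mod_cast this
  -- Multiplying the values for `g` and `-g` leaves only `g² = m₁ + 1`, so the product is rational.
  have h' : IsIntegral ℤ (((-4 : ℤ) : ℂ) / (m₀ ^ 2 * m₁ : ℤ)) := by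
    have e : ((-4 : ℤ) : ℂ) / (m₀ ^ 2 * m₁ : ℤ) =
        -2 * (gaussSum (complexQuadraticChar k₁) ψ₁ - 1) / ((m₀ * m₁ : ℕ) : ℂ) *
          (-2 * (gaussSum (complexQuadraticChar k₁) ψ₂ - 1) / ((m₀ * m₁ : ℕ) : ℂ)) := by
      rw [hg]
      push_cast
      field_simp
      linear_combination 4 * hsq
    rw [e]
    exact hprod
  obtain ⟨n, hn⟩ := exists_int_of_isIntegral_div h'
  have hden : ((m₀ ^ 2 * m₁ : ℤ) : ℂ) ≠ 0 := by
    push_cast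
    exact mul_ne_zero (pow_ne_zero _ hm₀0) hm₁0
  rw [eq_div_iff hden] at hn
  have hn' : n * (m₀ ^ 2 * m₁) = -4 := by exact_mod_cast hn
  have hdvd : ((m₀ : ℤ) ^ 2 * m₁) ∣ 4 := ⟨-n, by linarith⟩
  have hle := Int.le_of_dvd (by norm_num) hdvd
  have hm₀2 : (2 : ℤ) ≤ m₀ := by omega
  have hm₁4' : (4 : ℤ) ≤ m₁ := by omega
  nlinarith [mul_le_mul hm₀2 hm₀2 (by norm_num) (by omega)]

end Necessity

/-! ### The blow-up of a triangle -/

section Sufficiency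

variable {R : Type*} [CommRing R]

theorem mem_signedUnitSquares_iff_ne_zero [Finite R] (π : R →+* ZMod 3)
    (hπ : ∀ x, π x ≠ 0 → IsUnit x) (x : R) : x ∈ signedUnitSquares R ↔ π x ≠ 0 := by
  -- Squaring is injective on the fibre over `1`, because `y + z` lies over `2 ≠ 0` and is a unit;
  -- by finiteness it is surjective there.
  have key (x : R) (hx : π x = 1) : x ∈ unitSquares R := by
    let sq : {y : R // π y = 1} → {y : R // π y = 1} := fun y => ⟨y ^ 2, by simp [y.2]⟩
    have hinj : Function.Injective sq := by
      rintro ⟨y, hy⟩ ⟨z, hz⟩ h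
      have h1 : y ^ 2 = z ^ 2 := congrArg Subtype.val h
      have h2 : IsUnit (y + z) := hπ _ (by rw [map_add, hy, hz]; decide)
      have h3 : (y - z) * (y + z) = 0 := by linear_combination h1
      exact Subtype.ext (sub_eq_zero.1 ((h2.mul_left_eq_zero).1 h3))
    obtain ⟨⟨y, hy⟩, h⟩ := Finite.injective_iff_surjective.1 hinj ⟨x, hx⟩
    obtain ⟨u, rfl⟩ := hπ y (by rw [hy]; decide)
    exact ⟨u, (congrArg Subtype.val h).symm⟩
  constructor
  · intro hx
    obtain ⟨g, rfl⟩ := mem_signedUnitSquares_iff.1 hx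
    exact ((signedSquareHom R g).isUnit.map π).ne_zero
  · intro hx
    have h3 : ∀ a : ZMod 3, a ≠ 0 → a = 1 ∨ -a = 1 := by decide
    rcases h3 _ hx with h | h
    · exact Or.inl (key _ h)
    · exact Or.inr (key _ (by rw [map_neg, h]))

/-- The triangle has eigenvalues `2, -1`; the extra root `0` leaves no constant term, so the
relation survives pulling back along `π`. -/
theorem triangle_pow_three : ((Matrix.of fun _ _ => 1) - 1 : Matrix (ZMod 3) (ZMod 3) ℂ) *
      ((Matrix.of fun _ _ => 1) - 1) * ((Matrix.of fun _ _ => 1) - 1) =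
    ((Matrix.of fun _ _ => 1) - 1) * ((Matrix.of fun _ _ => 1) - 1) +
      (2 : ℂ) • ((Matrix.of fun _ _ => 1) - 1) := by
  set J : Matrix (ZMod 3) (ZMod 3) ℂ := Matrix.of fun _ _ => 1 with hJ
  have h : J * J = (3 : ℂ) • J := by
    ext i j
    simp [hJ, Matrix.mul_apply, ZMod.card]
  simp only [sub_mul, mul_sub, one_mul, mul_one, h, Matrix.smul_mul]
  module

variable [Nontrivial R] [Fintype R] [DecidableEq R]
  [DecidableRel (quadraticUnitaryCayleyGraph R).Adj]

theorem isGroverPeriodic_of_residue_field_three (π : R →+* ZMod 3)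
    (hπ : ∀ x, π x ≠ 0 → IsUnit x) : IsGroverPeriodic (quadraticUnitaryCayleyGraph R) := by
  classical
  have hsurj : Function.Surjective π := ZMod.ringHom_surjective π
  have hsum (F : ZMod 3 → ℂ) : (∑ x, F (π x)) = Fintype.card R / 3 * ∑ a, F a := by
    have h' := MonoidHom.sum_comp_mul_card (AddMonoidHom.toMultiplicative π.toAddMonoidHom) hsurj
      fun a => F a.toAdd
    rw [Fintype.card_multiplicative, Fintype.card_multiplicative, ZMod.card, Nat.cast_ofNat,
      ← Equiv.sum_comp (Multiplicative.ofAdd (α := R)),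
      ← Equiv.sum_comp (Multiplicative.ofAdd (α := ZMod 3))] at h'
    have h : (∑ x, F (π x)) * 3 = Fintype.card R * ∑ a, F a := h'
    linear_combination h / 3
  set m : ℂ := Fintype.card R / 3 with hm
  have hm0 : m ≠ 0 := by
    have : (Fintype.card R : ℂ) ≠ 0 := by exact_mod_cast Fintype.card_ne_zero
    exact div_ne_zero this three_ne_zero
  set K : Matrix (ZMod 3) (ZMod 3) ℂ := (Matrix.of fun _ _ => 1) - 1 with hK
  -- Each fibre of `π` has `m` elements, so after rescaling by `m⁻¹` pullback is multiplicative.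
  have hsub (L M : Matrix (ZMod 3) (ZMod 3) ℂ) :
      L.submatrix π π * M.submatrix π π = m • (L * M).submatrix π π := by
    ext x y
    simp only [Matrix.mul_apply, Matrix.submatrix_apply, Matrix.smul_apply, smul_eq_mul]
    exact hsum fun a => L (π x) a * M a (π y)
  have hA : (quadraticUnitaryCayleyGraph R).adjMatrix ℂ = K.submatrix π π := by
    ext x y
    simp only [SimpleGraph.adjMatrix_apply, quadraticUnitaryCayleyGraph_adj,
      mem_signedUnitSquares_iff_ne_zero π hπ, map_sub, sub_ne_zero]
    by_cases h : π x = π y <;> simp [hK, h]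
  have hd : ((Finset.univ.filter (· ∈ signedUnitSquares R)).card : ℂ) = 2 * m := by
    rw [← Finset.sum_boole]
    simp only [mem_signedUnitSquares_iff_ne_zero π hπ]
    rw [hsum fun a => if a ≠ 0 then 1 else 0, Finset.sum_boole]
    have : (Finset.univ.filter fun a : ZMod 3 => a ≠ 0).card = 2 := by decide
    rw [this]
    push_cast
    ring
  refine isGroverPeriodic_of_pow_three _ quadraticUnitaryCayleyGraph_isRegularOfDegree
    card_signedUnitSquares_pos (q := m⁻¹ • K.submatrix π π) ?_ ?_
  · rw [hA, hd]
    congr 1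
    field_simp
  · have h2 (L M : Matrix (ZMod 3) (ZMod 3) ℂ) :
        (m⁻¹ • L.submatrix π π) * (m⁻¹ • M.submatrix π π) = m⁻¹ • (L * M).submatrix π π := by
      rw [smul_mul_smul_comm, hsub, smul_smul]
      congr 1
      field_simp
    rw [h2, h2, hK, triangle_pow_three, ← hK, submatrix_add, submatrix_smul]
    simp only [Pi.add_apply, Pi.smul_apply, smul_add]
    rw [smul_comm]

end Sufficiency

/-! ### Residue fields of the local factors -/

section LocalDecomposition

open IsLocalRing

variable {R ι : Type*} [CommRing R] {A : ι → Type*} [∀ i, CommRing (A i)] [∀ i, IsLocalRing (A i)]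

/-- The projection of a product of local rings to the residue field of a factor. -/
noncomputable def factorResidue (e : R ≃+* ((i : ι) → A i)) (i : ι) : R →+* ResidueField (A i) :=
  (residue (A i)).comp ((Pi.evalRingHom A i).comp e.toRingHom)

/-- Units lift along the local homomorphism to each residue field, and coordinates are independent.
This supplies the surjectivity on units that the character averages need. -/
theorem exists_unit_factorResidue_eq (e : R ≃+* ((i : ι) → A i))
    (w : ∀ i, (ResidueField (A i))ˣ) : ∃ u : Rˣ, ∀ i, factorResidue e i u = w i := by
  have h i := surjective_units_map_of_local_ringHom (residue (A i)) residue_surjective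
    inferInstance (w i)
  choose a ha using h
  refine ⟨Units.map e.symm.toRingHom.toMonoidHom (MulEquiv.piUnits.symm a), fun i => ?_⟩
  rw [← ha]
  simp [factorResidue]

theorem card_residueField_eq_div [Finite R] (e : R ≃+* ((i : ι) → A i)) (i : ι) :
    Finite (A i) ∧ Nat.card (A i) / Nat.card (maximalIdeal (A i)) =
      Nat.card (ResidueField (A i)) := by
  have : Finite (A i) := Finite.of_surjective _
    ((Function.surjective_eval i).comp e.surjective)
  refine ⟨this, ?_⟩
  rw [Submodule.card_eq_card_quotient_mul_card (maximalIdeal (A i)),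
    Nat.mul_div_cancel_left _ Nat.card_pos]
  rfl

end LocalDecomposition

/-- `R` is a finite commutative ring identified with the product of the finite local
rings `A 0, …, A s`. -/
theorem theorem5p8 {R : Type*} [CommRing R] [Fintype R] [DecidableEq R]
    [DecidableRel (quadraticUnitaryCayleyGraph R).Adj]
    (s : ℕ) (A : Fin (s + 1) → Type*) [∀ i, CommRing (A i)] [∀ i, IsLocalRing (A i)]
    (e : R ≃+* ((i : Fin (s + 1)) → A i))
    (h0 : Nat.card (A 0) / Nat.card (IsLocalRing.maximalIdeal (A 0)) ≡ 3 [MOD 4])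
    (h1 : ∀ i : Fin (s + 1), i ≠ 0 →
      Nat.card (A i) / Nat.card (IsLocalRing.maximalIdeal (A i)) ≡ 1 [MOD 4]) :
    IsGroverPeriodic (quadraticUnitaryCayleyGraph R) ↔
      s = 0 ∧ Nonempty ((A 0 ⧸ IsLocalRing.maximalIdeal (A 0)) ≃+* ZMod 3) := by
  have : Nontrivial R := e.toEquiv.nontrivial
  have hfin i : Finite (A i) := (card_residueField_eq_div e i).1
  have hfink i : Finite (IsLocalRing.ResidueField (A i)) :=
    Finite.of_surjective _ IsLocalRing.residue_surjective
  let hfint i : Fintype (IsLocalRing.ResidueField (A i)) := Fintype.ofFinite _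
  rw [(card_residueField_eq_div e 0).2, Nat.card_eq_fintype_card] at h0
  constructor
  · intro hper
    have hs : s = 0 := by
      by_contra hs
      let i : Fin (s + 1) := ⟨1, by omega⟩
      have hi : i ≠ 0 := by simp [i, Fin.ext_iff]
      have hi1 := h1 i hi
      rw [(card_residueField_eq_div e i).2, Nat.card_eq_fintype_card] at hi1
      refine not_isGroverPeriodic_of_two_residue_fields
        ((factorResidue e 0).prod (factorResidue e i)) ?_ h0 hi1 hper
      intro w
      -- Prescribe `w` in coordinates `0` and `i`, and `1` elsewhere.
      obtain ⟨u, hu⟩ := exists_unit_factorResidue_eq e (Function.update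
        (Function.update 1 i (MulEquiv.prodUnits w).2) 0 (MulEquiv.prodUnits w).1)
      refine ⟨u, Units.ext (Prod.ext ?_ ?_)⟩
      · refine (hu 0).trans ?_
        rw [Function.update_self]
        rfl
      · refine (hu i).trans ?_
        rw [Function.update_of_ne hi, Function.update_self]
        rfl
    refine ⟨hs, ?_⟩
    have hcard := card_eq_three_of_isGroverPeriodic hper (factorResidue e 0) (fun w => by
      obtain ⟨u, hu⟩ := exists_unit_factorResidue_eq e (Function.update 1 0 w)
      refine ⟨u, Units.ext ((hu 0).trans (by simp))⟩) h0
    exact ⟨(ZMod.ringEquivOfPrime (IsLocalRing.ResidueField (A 0)) Nat.prime_three hcard).symm⟩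
  · rintro ⟨rfl, ⟨f⟩⟩
    let f' : IsLocalRing.ResidueField (A 0) ≃+* ZMod 3 := f
    refine isGroverPeriodic_of_residue_field_three (f'.toRingHom.comp (factorResidue e 0)) ?_
    intro x hx
    have hx0 : IsLocalRing.residue (A 0) (e x 0) ≠ 0 := fun h => hx (by
      have : factorResidue e 0 x = 0 := h
      simp [this])
    have hunit : IsUnit (e x) := by
      rw [Pi.isUnit_iff]
      intro i
      rw [Fin.eq_zero i]
      exact (IsLocalRing.residue_ne_zero_iff_isUnit _).1 hx0
    exact (MulEquiv.isUnit_map e).1 hunit
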